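/- Let $X$ be a complex Banach space, $T\in L(X)$ a bounded linear operator on $X$, and let $\sigma_*\in\{\sigma,\sigma_b,\sigma_d\}$, where $\sigma(T)$ is the spectrum, $\sigma_b(T)=\{\lambda\in\mathbb{C}: T-\lambda I \text{ is not Browder}\}$ and $\sigma_d(T)=\{\lambda\in\mathbb{C}: T-\lambda I\text{ is not Drazin invertible}\}$. (An operator is Drazin invertible if it has finite ascent and finite descent, and Browder if it is moreover Fredholm.) For $A\subset\mathbb{C}$ let $\operatorname{acc}A$ be the set of accumulation points of $A$ and define, by transfinite recursion, $\operatorname{acc}^{0}A=A$, $\operatorname{acc}^{\gamma+1}A=\operatorname{acc}(\operatorname{acc}^{\gamma}A)$, and $\operatorname{acc}^{\lambda}A=\bigcap_{\beta<\lambda}\operatorname{acc}^{\beta}A$ for limit ordinals $\lambda$. For a $T$-invariant subspace $M$ (that is, $T(M)\subset M$), $T_M:M\to M$ denotes the restriction of $T$. Let $\alpha\ge 1$ be a successor ordinal with predecessor $\alpha-1$. The operator $T$ is called $g^{\alpha}_{\sigma_*}$-invertible if there are closed $T$-invariant subspaces $M,N$ of $X$ such that $X=M\oplus N$, $T_M$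 is invertible in $L(M)$, and $\operatorname{acc}^{\alpha-1}\sigma_*(T_N)\subset\{0\}$. Theorem. $T$ is $g^{\alpha}_{\sigma_*}$-invertible if and only if there are $T$-invariant linear subspaces $M,N$ of $X$ such that $N$ is closed, $X=M\oplus N$ (algebraic direct sum; $M$ is not assumed closed), $T_M$ is invertible, i.e. $T_M:M\to M$ is bijective, and $\operatorname{acc}^{\alpha-1}\sigma_*(T_N)\subset\{0\}$. -/

import Mathlib

open Filter Topology

universe u v

/-- The `α`-th Cantor-Bendixson derivative `acc^α A` of a set `A`: start from `A`, take the set of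
accumulation points at successor steps and intersections at limit steps. -/
noncomputable def accIter {Y : Type u} [TopologicalSpace Y] (A : Set Y) (α : Ordinal.{v}) : Set Y :=
  Ordinal.limitRecOn α A (fun _ S => derivedSet S) (fun β _ S => ⋂ γ, ⋂ h : γ < β, S γ h)

theorem accIter_zero {Y : Type u} [TopologicalSpace Y] (A : Set Y) :
    accIter A (0 : Ordinal.{v}) = A :=
  Ordinal.limitRecOn_zero _ _ _

theorem accIter_add_one {Y : Type u} [TopologicalSpace Y] (A : Set Y) (α : Ordinal.{v}) :
    accIter A (α + 1) = derivedSet (accIter A α) :=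
  Ordinal.limitRecOn_add_one _ _ _ _

theorem accIter_limit {Y : Type u} [TopologicalSpace Y] (A : Set Y) (α : Ordinal.{v})
    (hα : Order.IsSuccLimit α) : accIter A α = ⋂ γ, ⋂ _ : γ < α, accIter A γ :=
  Ordinal.limitRecOn_limit _ _ _ _ hα

section Operators

variable {X : Type u} [NormedAddCommGroup X] [NormedSpace ℂ X]

/-- Finite ascent: `N(T^p) = N(T^(p+1))` for some `p`. -/
def HasFiniteAscent (T : X →L[ℂ] X) : Prop :=
  ∃ p : ℕ, (T ^ p).ker = (T ^ (p + 1)).ker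

/-- Finite descent: `R(T^q) = R(T^(q+1))` for some `q`. -/
def HasFiniteDescent (T : X →L[ℂ] X) : Prop :=
  ∃ q : ℕ, (T ^ q).range = (T ^ (q + 1)).range

/-- Drazin invertible operators: finite ascent and finite descent. -/
def IsDrazinInvertible (T : X →L[ℂ] X) : Prop :=
  HasFiniteAscent T ∧ HasFiniteDescent T

/-- Browder operators: Fredholm operators of finite ascent and finite descent. -/
def IsBrowder (T : X →L[ℂ] X) : Prop :=
  T.IsFredholm ∧ HasFiniteAscent T ∧ HasFiniteDescent T

/-- The Browder spectrum. -/
def browderSpectrum (T : X →L[ℂ] X) : Set ℂ :=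
  {z | ¬ IsBrowder (T - z • ContinuousLinearMap.id ℂ X)}

/-- The Drazin spectrum. -/
def drazinSpectrum (T : X →L[ℂ] X) : Set ℂ :=
  {z | ¬ IsDrazinInvertible (T - z • ContinuousLinearMap.id ℂ X)}

/-- The three possible choices for `σ_*`. -/
inductive SpectrumKind
  | usual
  | browder
  | drazin

/-- The spectrum `σ_*(T)`, where `σ_*` is one of `σ`, `σ_b`, `σ_d`. -/
def sigmaStar (k : SpectrumKind) (T : X →L[ℂ] X) : Set ℂ :=
  match k with
  | .usual => spectrum ℂ T
  | .browder => browderSpectrum T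
  | .drazin => drazinSpectrum T

/-- A subspace `M` is `T`-invariant if `T(M) ⊆ M`. -/
def IsInvariantSubspace (T : X →L[ℂ] X) (M : Submodule ℂ X) : Prop :=
  ∀ x ∈ M, T x ∈ M

/-- There are closed `T`-invariant subspaces `M`, `N` with `X = M ⊕ N`, `T_M` invertible in `L(M)`
and `acc^γ σ_*(T_N) ⊆ {0}`. -/
def HasGDecomposition (k : SpectrumKind) (T : X →L[ℂ] X) (γ : Ordinal.{v}) : Prop :=
  ∃ (M N : Submodule ℂ X) (hM : IsInvariantSubspace T M) (hN : IsInvariantSubspace T N),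
    IsClosed (M : Set X) ∧ IsClosed (N : Set X) ∧ IsCompl M N ∧
      IsUnit (T.restrict hM) ∧ accIter (sigmaStar k (T.restrict hN)) γ ⊆ {0}

/-- `g^α_{σ_*}`-invertible operators. The three disjuncts are the cases `α = 0`, `α` a successor
ordinal and `α` a limit ordinal. -/
def IsGInvertible (k : SpectrumKind) (T : X →L[ℂ] X) (α : Ordinal.{v}) : Prop :=
  (α = 0 ∧ (0 : ℂ) ∉ sigmaStar k T) ∨
  (∃ γ : Ordinal.{v}, α = γ + 1 ∧ HasGDecomposition k T γ) ∨
  (Order.IsSuccLimit α ∧ ∃ γ : Ordinal.{v}, γ + 1 < α ∧ HasGDecomposition k T γ)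

end Operators

/-! The complement `M` is only used to see that `T` induces a bijection on `X ⧸ N`. Bijectivity on
the Banach space `X ⧸ N` is stable, so `T - z` induces a bijection on `X ⧸ N` for all small `z`. For
such `z` the operator `T - z` is regular if its restriction to `N` is, so `σ_*(T) ⊆ σ_*(T_N)` in a
disc around `0`.

A Drazin invertible operator `S` is, for large `n`, nilpotent on `ker (S ^ n)` and bijective modulo
`ker (S ^ n)`, so that `S - z` is bijective for all small `z ≠ 0`. Hence `acc σ(T) ⊆ σ_*(T)`, and in
the above disc `acc^γ (acc σ(T)) ⊆ {0}`. An uncountable closed set contains a nonempty perfect set,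
which survives every derivative, so `σ(T)` is countable in the disc and some small circle around `0`
misses it. The Riesz projection of that circle yields closed subspaces `M'` and `N'` with `T_M'`
invertible and `σ_*(T_N')` contained in the part of `σ_*(T)` inside the disc, hence in
`σ_*(T_N)`. -/

section CantorBendixson

variable {Y : Type u} [TopologicalSpace Y]

theorem accIter_mono {A B : Set Y} (h : A ⊆ B) (α : Ordinal.{v}) :
    accIter A α ⊆ accIter B α := by
  induction α using Ordinal.limitRecOn with
  | zero => simpa only [accIter_zero] using h
  | add_one α ih =>
    rw [accIter_add_one, accIter_add_one]
    exact derivedSet_mono _ _ ih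
  | limit α hα ih =>
    rw [accIter_limit _ _ hα, accIter_limit _ _ hα]
    exact Set.iInter₂_mono ih

theorem subset_accIter_of_preperfect {D : Set Y} (hD : Preperfect D) (α : Ordinal.{v}) :
    D ⊆ accIter D α := by
  induction α using Ordinal.limitRecOn with
  | zero => rw [accIter_zero]
  | add_one α ih =>
    rw [accIter_add_one]
    exact (preperfect_iff_subset_derivedSet.1 hD).trans (derivedSet_mono _ _ ih)
  | limit α hα ih =>
    rw [accIter_limit _ _ hα]
    exact Set.subset_iInter₂ ih

theorem nontrivial_of_preperfect {D : Set Y} (hD : Preperfect D) (hne : D.Nonempty) :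
    D.Nontrivial := by
  obtain ⟨x, hx⟩ := hne
  obtain ⟨y, hy, hyx⟩ := accPt_iff_nhds.1 (hD x hx) Set.univ univ_mem
  exact ⟨y, hy.2, x, hx, hyx⟩

theorem countable_of_subsingleton_accIter_derivedSet [SecondCountableTopology Y] {C : Set Y}
    (hC : IsClosed C) {α : Ordinal.{v}} (h : (accIter (derivedSet C) α).Subsingleton) :
    C.Countable := by
  by_contra hC'
  obtain ⟨D, hD, hne, hDC⟩ := exists_perfect_nonempty_of_isClosed_of_not_countable hC hC'
  have hD' : D ⊆ derivedSet C :=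
    (preperfect_iff_subset_derivedSet.1 hD.acc).trans (derivedSet_mono _ _ hDC)
  exact (nontrivial_of_preperfect hD.acc hne).not_subsingleton
    (h.anti ((subset_accIter_of_preperfect hD.acc α).trans (accIter_mono hD' α)))

theorem exists_sphere_subset_compl_of_countable {E : Type*} [PseudoMetricSpace E] {C : Set E}
    (hC : C.Countable) (x : E) {ε : ℝ} (hε : 0 < ε) :
    ∃ r ∈ Set.Ioo 0 ε, Metric.sphere x r ⊆ Cᶜ := by
  obtain ⟨r, hr, hrε⟩ := ((hC.image (dist · x)).dense_compl ℝ).exists_mem_open isOpen_Ioo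
    (Set.nonempty_Ioo.2 hε)
  exact ⟨r, hrε, fun z hz hzC => hr ⟨z, hzC, hz⟩⟩

end CantorBendixson

section InvariantSubmodule

variable {R V : Type*} [Ring R] [AddCommGroup V] [Module R V] {f : V →ₗ[R] V}
  {M N : Submodule R V} (hM : ∀ x ∈ M, f x ∈ M) (hN : ∀ x ∈ N, f x ∈ N)

theorem comap_eq_of_injective_mapQ (h : Function.Injective (N.mapQ N f hN)) : N.comap f = N := by
  refine le_antisymm (fun x hx => ?_) hN
  rw [← Submodule.Quotient.mk_eq_zero]
  exact (map_eq_zero_iff _ h).1 ((Submodule.Quotient.mk_eq_zero N).2 hx)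

theorem ker_eq_map_ker_restrict_of_injective_mapQ (h : Function.Injective (N.mapQ N f hN)) :
    f.ker = (f.restrict hN).ker.map N.subtype := by
  have hle : f.ker ≤ N := (f.ker_le_comap).trans_eq (comap_eq_of_injective_mapQ hN h)
  rw [LinearMap.ker_restrict, Submodule.map_comap_subtype, inf_eq_right.2 hle]

theorem range_sup_eq_top_of_surjective_mapQ (h : Function.Surjective (N.mapQ N f hN)) :
    f.range ⊔ N = ⊤ := by
  rw [sup_comm, ← Submodule.map_mkQ_eq_top, ← Submodule.range_mapQ (h := hN),
    LinearMap.range_eq_top.2 h]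

theorem range_restrict_eq_comap_range (h : f.range ⊓ N ≤ N.map f) :
    (f.restrict hN).range = f.range.comap N.subtype := by
  rw [LinearMap.range_restrict]
  exact le_antisymm (Submodule.comap_mono LinearMap.map_le_range) fun x hx => h ⟨hx, x.2⟩

theorem range_restrict_of_injective_mapQ (h : Function.Injective (N.mapQ N f hN)) :
    (f.restrict hN).range = f.range.comap N.subtype := by
  refine range_restrict_eq_comap_range hN ?_
  rw [← Submodule.map_comap_eq, comap_eq_of_injective_mapQ hN h]

include hM in
theorem range_restrict_of_isCompl (h : IsCompl M N) :
    (f.restrict hN).range = f.range.comap N.subtype := by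
  refine range_restrict_eq_comap_range hN ?_
  rintro _ ⟨⟨x, rfl⟩, hx : f x ∈ N⟩
  obtain ⟨m, hm, n, hn, rfl⟩ := Submodule.mem_sup.1 (h.sup_eq_top ▸ Submodule.mem_top (x := x))
  rw [map_add, Submodule.add_mem_iff_left _ (hN n hn)] at hx
  rw [map_add, Submodule.disjoint_def.1 h.disjoint _ (hM m hm) hx, zero_add]
  exact ⟨n, hn, rfl⟩

theorem bijective_mapQ_of_isCompl (h : IsCompl M N) (hf : Function.Bijective (f.restrict hM)) :
    Function.Bijective (N.mapQ N f hN) := by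
  let e := N.quotientEquivOfIsCompl M h.symm
  have he : N.mapQ N f hN ∘ e.symm = e.symm ∘ f.restrict hM := by
    ext m
    simp [e]
  rw [← e.symm.bijective.of_comp_iff, he]
  exact e.symm.bijective.comp hf

theorem bijective_of_restrict_of_mapQ (hf : Function.Bijective (f.restrict hN))
    (h : Function.Bijective (N.mapQ N f hN)) : Function.Bijective f := by
  constructor
  · rw [← LinearMap.ker_eq_bot, ker_eq_map_ker_restrict_of_injective_mapQ hN h.1,
      LinearMap.ker_eq_bot.2 hf.1, Submodule.map_bot]
  · have hle : N ≤ f.range := by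
      rw [← Submodule.comap_subtype_eq_top, ← range_restrict_of_injective_mapQ hN h.1,
        LinearMap.range_eq_top.2 hf.2]
    rw [← LinearMap.range_eq_top, ← sup_eq_left.2 hle, range_sup_eq_top_of_surjective_mapQ hN h.2]

include hM in
theorem bijective_restrict_of_isCompl (h : IsCompl M N) (hf : Function.Bijective f) :
    Function.Bijective (f.restrict hN) := by
  constructor
  · exact fun x y hxy => Subtype.ext (hf.1 (congrArg Subtype.val hxy))
  · rw [← LinearMap.range_eq_top, range_restrict_of_isCompl hM hN h,
      LinearMap.range_eq_top.2 hf.2, Submodule.comap_top]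

theorem finite_ker_restrict [IsNoetherianRing R] [Module.Finite R f.ker] :
    Module.Finite R (f.restrict hN).ker := by
  have hle : (f.restrict hN).ker.map N.subtype ≤ f.ker := by
    rw [LinearMap.ker_restrict]
    exact Submodule.map_comap_le _ _
  exact .of_fg (Submodule.fg_of_fg_map_injective N.subtype N.subtype_injective
    (Submodule.FG.of_le (.of_finite) hle))

theorem cofg_comap_subtype [IsNoetherianRing R] {S : Submodule R V} (hS : S.CoFG)
    (N : Submodule R V) : (S.comap N.subtype).CoFG := by
  have : Module.Finite R (V ⧸ S) := hS
  simpa only [LinearMap.ker_comp, Submodule.ker_mkQ] using Submodule.CoFG.ker (S.mkQ ∘ₗ N.subtype)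

theorem cofg_of_comap_subtype {S : Submodule R V} (hSN : S ⊔ N = ⊤)
    (h : (S.comap N.subtype).CoFG) : S.CoFG := by
  have := h
  refine Module.Finite.of_surjective (Submodule.mapQ (S.comap N.subtype) S N.subtype le_rfl) ?_
  rw [← LinearMap.range_eq_top, Submodule.range_mapQ, Submodule.range_subtype,
    Submodule.map_mkQ_eq_top, hSN]

theorem bijective_mapQ_ker_pow {n : ℕ} (hker : (f ^ n).ker = (f ^ (n + 1)).ker)
    (hrange : (f ^ n).range = (f ^ (n + 1)).range)
    (hf : ∀ x ∈ (f ^ n).ker, f x ∈ (f ^ n).ker) :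
    Function.Bijective ((f ^ n).ker.mapQ (f ^ n).ker f hf) := by
  constructor
  · rw [← LinearMap.ker_eq_bot, Submodule.ker_mapQ, ← LinearMap.ker_comp, ← Module.End.mul_eq_comp,
      ← pow_succ, ← hker, Submodule.mkQ_map_self]
  · rw [← LinearMap.range_eq_top, Submodule.range_mapQ, Submodule.map_mkQ_eq_top, sup_comm,
      ← Submodule.comap_map_eq, ← LinearMap.range_comp, ← Module.End.mul_eq_comp, ← pow_succ,
      ← hrange]
    exact LinearMap.range_le_iff_comap.1 le_rfl

end InvariantSubmodule

section Fredholm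

variable {𝕜 E F : Type*} [RCLike 𝕜] [NormedAddCommGroup E] [NormedSpace 𝕜 E] [CompleteSpace E]
  [NormedAddCommGroup F] [NormedSpace 𝕜 F] [CompleteSpace F] {S : E →L[𝕜] F}

theorem isClosed_range_of_cofg (h : S.range.CoFG) : IsClosed (S.range : Set F) := by
  obtain ⟨G, hG⟩ := S.range.exists_isCompl
  have : FiniteDimensional 𝕜 G := .of_fg (h.fg_of_isCompl hG)
  have : IsClosed (S.ker : Set E) := S.isClosed_ker
  let S' : E ⧸ S.ker →L[𝕜] F := S.ker.liftQL S le_rfl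
  have hrange : S'.range = S.range := S.ker.range_liftQ (S : E →ₗ[𝕜] F) le_rfl
  have hker : S'.ker = ⊥ := S.ker.ker_liftQ_eq_bot (S : E →ₗ[𝕜] F) le_rfl le_rfl
  rw [← hrange] at hG ⊢
  exact S'.closed_complemented_range_of_isCompl_of_ker_eq_bot G hG
    G.closed_of_finiteDimensional hker

theorem isFredholm_of_finite_ker_of_cofg_range [FiniteDimensional 𝕜 S.ker]
    (h : S.range.CoFG) : S.IsFredholm where
  isStrictMap := by
    have := (isClosed_range_of_cofg h).completeSpace_coe
    exact S.rangeRestrict.isQuotientMap S.toLinearMap.surjective_rangeRestrict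
  isClosed_range := isClosed_range_of_cofg h
  finite_ker := inferInstance
  finite_coker := h
  closedComplemented_ker := .of_finiteDimensional _

end Fredholm

section AscentDescent

variable {X : Type u} [NormedAddCommGroup X] [NormedSpace ℂ X] {S T : X →L[ℂ] X}
  {M N : Submodule ℂ X}

theorem hasFiniteAscent_of_injective (hS : Function.Injective S) : HasFiniteAscent S := by
  refine ⟨0, ?_⟩
  rw [zero_add, pow_one, pow_zero, LinearMap.ker_eq_bot.2 hS]
  exact LinearMap.ker_id

theorem hasFiniteDescent_of_surjective (hS : Function.Surjective S) : HasFiniteDescent S := by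
  refine ⟨0, ?_⟩
  rw [zero_add, pow_one, pow_zero, LinearMap.range_eq_top.2 hS]
  exact LinearMap.range_id

theorem isBrowder_of_bijective [CompleteSpace X] (hS : Function.Bijective S) : IsBrowder S := by
  have : FiniteDimensional ℂ S.ker := by
    rw [LinearMap.ker_eq_bot.2 hS.1]
    infer_instance
  have : S.range.CoFG := by
    rw [LinearMap.range_eq_top.2 hS.2]
    exact .top
  exact ⟨isFredholm_of_finite_ker_of_cofg_range this, hasFiniteAscent_of_injective hS.1,
    hasFiniteDescent_of_surjective hS.2⟩

namespace IsInvariantSubspace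

/-- The operator induced by `T` on the quotient of the space by an invariant subspace. -/
def quotientMap (hN : IsInvariantSubspace T N) : X ⧸ N →L[ℂ] X ⧸ N :=
  N.liftQL (N.mkQL ∘L T) fun x hx => (Submodule.Quotient.mk_eq_zero N).2 (hN x hx)

theorem toLinearMap_quotientMap (hN : IsInvariantSubspace T N) :
    (hN.quotientMap : X ⧸ N →ₗ[ℂ] X ⧸ N) = N.mapQ N T.toLinearMap hN := rfl

theorem pow (hN : IsInvariantSubspace T N) (n : ℕ) : IsInvariantSubspace (T ^ n) N :=
  fun x hx => by
    rw [FunLike.coe_pow_eq_iterate]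
    exact Set.MapsTo.iterate hN n hx

theorem quotientMap_pow (hN : IsInvariantSubspace T N) (n : ℕ) :
    (hN.pow n).quotientMap = hN.quotientMap ^ n := by
  refine ContinuousLinearMap.coe_inj.1 ?_
  simp only [toLinearMap_quotientMap, ContinuousLinearMap.toLinearMap_pow]
  exact N.mapQ_pow hN n

theorem restrict_pow (hN : IsInvariantSubspace T N) (n : ℕ) :
    (T ^ n).restrict (hN.pow n) = T.restrict hN ^ n := by
  have hsemi : Function.Semiconj N.subtype (T.restrict hN) T := fun _ => rfl
  ext x
  change (T ^ n) x = ((T.restrict hN ^ n) x : X)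
  rw [FunLike.coe_pow_eq_iterate, FunLike.coe_pow_eq_iterate]
  exact (hsemi.iterate_right n x).symm

theorem sub_smul_id (hN : IsInvariantSubspace T N) (z : ℂ) :
    IsInvariantSubspace (T - z • ContinuousLinearMap.id ℂ X) N :=
  fun x hx => N.sub_mem (hN x hx) (N.smul_mem z hx)

theorem hasFiniteAscent (hN : IsInvariantSubspace S N)
    (hQ : Function.Injective hN.quotientMap) (h : HasFiniteAscent (S.restrict hN)) :
    HasFiniteAscent S := by
  obtain ⟨p, hp⟩ := h
  have hker (n : ℕ) : (S ^ n).ker = (S.restrict hN ^ n).ker.map N.subtype := by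
    have hQn : Function.Injective (hN.pow n).quotientMap := by
      rw [hN.quotientMap_pow, FunLike.coe_pow_eq_iterate]
      exact hQ.iterate n
    rw [← hN.restrict_pow]
    exact ker_eq_map_ker_restrict_of_injective_mapQ (hN.pow n) hQn
  exact ⟨p, by rw [hker, hker, hp]⟩

theorem hasFiniteDescent (hN : IsInvariantSubspace S N)
    (hQ : Function.Bijective hN.quotientMap) (h : HasFiniteDescent (S.restrict hN)) :
    HasFiniteDescent S := by
  obtain ⟨q, hq⟩ := h
  have hQ_pow (n : ℕ) : Function.Bijective (hN.pow n).quotientMap := by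
    rw [hN.quotientMap_pow, FunLike.coe_pow_eq_iterate]
    exact hQ.iterate n
  have hrange (n : ℕ) : (S.restrict hN ^ n).range = (S ^ n).range.comap N.subtype := by
    rw [← hN.restrict_pow]
    exact range_restrict_of_injective_mapQ (hN.pow n) (hQ_pow n).1
  have hle : (S ^ (q + 1)).range ≤ (S ^ q).range := by
    rw [pow_succ]
    exact LinearMap.range_comp_le_range _ _
  refine ⟨q, (eq_of_le_of_inf_le_of_le_sup (z := N) hle ?_ ?_).symm⟩
  · rw [hrange, hrange] at hq
    exact fun x hx => (SetLike.ext_iff.1 hq ⟨x, hx.2⟩).1 hx.1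
  · exact le_top.trans_eq
      (range_sup_eq_top_of_surjective_mapQ (hN.pow (q + 1)) (hQ_pow (q + 1)).2).symm

theorem isFredholm [CompleteSpace X] (hN : IsInvariantSubspace S N)
    (hQ : Function.Bijective hN.quotientMap) (h : (S.restrict hN).IsFredholm) : S.IsFredholm := by
  have : FiniteDimensional ℂ S.ker := by
    have := h.finite_ker
    rw [ker_eq_map_ker_restrict_of_injective_mapQ hN hQ.1]
    exact Module.Finite.map (S.restrict hN).ker _
  refine isFredholm_of_finite_ker_of_cofg_range (cofg_of_comap_subtype
    (range_sup_eq_top_of_surjective_mapQ hN hQ.2) ?_)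
  rw [← range_restrict_of_injective_mapQ hN hQ.1]
  exact h.finite_coker

theorem hasFiniteAscent_restrict (hN : IsInvariantSubspace S N) (h : HasFiniteAscent S) :
    HasFiniteAscent (S.restrict hN) := by
  obtain ⟨p, hp⟩ := h
  have hker (n : ℕ) : (S.restrict hN ^ n).ker = (S ^ n).ker.comap N.subtype := by
    rw [← hN.restrict_pow]
    exact LinearMap.ker_restrict (hN.pow n)
  exact ⟨p, by rw [hker, hker, hp]⟩

theorem hasFiniteDescent_restrict (hM : IsInvariantSubspace S M) (hN : IsInvariantSubspace S N)
    (hMN : IsCompl M N) (h : HasFiniteDescent S) : HasFiniteDescent (S.restrict hN) := by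
  obtain ⟨q, hq⟩ := h
  have hrange (n : ℕ) : (S.restrict hN ^ n).range = (S ^ n).range.comap N.subtype := by
    rw [← hN.restrict_pow]
    exact range_restrict_of_isCompl (hM.pow n) (hN.pow n) hMN
  exact ⟨q, by rw [hrange, hrange, hq]⟩

theorem isFredholm_restrict [CompleteSpace X] (hM : IsInvariantSubspace S M)
    (hN : IsInvariantSubspace S N) (hMN : IsCompl M N) (hNc : IsClosed (N : Set X))
    (h : S.IsFredholm) : (S.restrict hN).IsFredholm := by
  have := hNc.completeSpace_coe
  have := h.finite_ker
  have : FiniteDimensional ℂ (S.restrict hN).ker := finite_ker_restrict hN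
  refine isFredholm_of_finite_ker_of_cofg_range ?_
  have hrange : (S.restrict hN).range = S.range.comap N.subtype :=
    range_restrict_of_isCompl hM hN hMN
  rw [hrange]
  exact cofg_comap_subtype h.finite_coker N

end IsInvariantSubspace

end AscentDescent

section SigmaStar

variable {X : Type u} [NormedAddCommGroup X] [NormedSpace ℂ X] {S T : X →L[ℂ] X}
  {M N : Submodule ℂ X} {k : SpectrumKind}

/-- `S` is invertible, Browder or Drazin invertible, according to `k`: the property of `T - z` whose
failure defines `sigmaStar k T`. -/
def IsRegularOperator (k : SpectrumKind) (S : X →L[ℂ] X) : Prop :=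
  match k with
  | .usual => Function.Bijective S
  | .browder => IsBrowder S
  | .drazin => IsDrazinInvertible S

theorem mem_spectrum_iff_not_bijective [CompleteSpace X] {z : ℂ} :
    z ∈ spectrum ℂ T ↔ ¬ Function.Bijective (T - z • ContinuousLinearMap.id ℂ X) := by
  rw [spectrum.mem_iff, ← IsUnit.neg_iff, neg_sub, ContinuousLinearMap.isUnit_iff_bijective]
  rfl

theorem mem_sigmaStar_iff [CompleteSpace X] {z : ℂ} :
    z ∈ sigmaStar k T ↔ ¬ IsRegularOperator k (T - z • ContinuousLinearMap.id ℂ X) := by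
  cases k with
  | usual => exact mem_spectrum_iff_not_bijective
  | browder => rfl
  | drazin => rfl

theorem isRegularOperator_of_bijective [CompleteSpace X] (hS : Function.Bijective S) :
    IsRegularOperator k S := by
  cases k with
  | usual => exact hS
  | browder => exact isBrowder_of_bijective hS
  | drazin => exact (isBrowder_of_bijective hS).2

theorem sigmaStar_subset_spectrum [CompleteSpace X] : sigmaStar k T ⊆ spectrum ℂ T := fun _ hz =>
  mem_spectrum_iff_not_bijective.2 (mt isRegularOperator_of_bijective (mem_sigmaStar_iff.1 hz))

namespace IsRegularOperator

theorem isDrazinInvertible [CompleteSpace X] (h : IsRegularOperator k S) :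
    IsDrazinInvertible S := by
  cases k with
  | usual => exact (isBrowder_of_bijective h).2
  | browder => exact h.2
  | drazin => exact h

theorem of_restrict [CompleteSpace X] (hN : IsInvariantSubspace S N)
    (hQ : Function.Bijective hN.quotientMap) (h : IsRegularOperator k (S.restrict hN)) :
    IsRegularOperator k S := by
  cases k with
  | usual => exact bijective_of_restrict_of_mapQ hN h hQ
  | browder => exact ⟨hN.isFredholm hQ h.1, hN.hasFiniteAscent hQ.1 h.2.1,
      hN.hasFiniteDescent hQ h.2.2⟩
  | drazin => exact ⟨hN.hasFiniteAscent hQ.1 h.1, hN.hasFiniteDescent hQ h.2⟩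

theorem restrict [CompleteSpace X] (h : IsRegularOperator k S) (hM : IsInvariantSubspace S M)
    (hN : IsInvariantSubspace S N) (hNc : IsClosed (N : Set X)) (hMN : IsCompl M N) :
    IsRegularOperator k (S.restrict hN) := by
  cases k with
  | usual => exact bijective_restrict_of_isCompl hM hN hMN h
  | browder => exact ⟨hM.isFredholm_restrict hN hMN hNc h.1, hN.hasFiniteAscent_restrict h.2.1,
      hM.hasFiniteDescent_restrict hN hMN h.2.2⟩
  | drazin => exact ⟨hN.hasFiniteAscent_restrict h.1, hM.hasFiniteDescent_restrict hN hMN h.2⟩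

end IsRegularOperator

theorem sigmaStar_restrict_subset [CompleteSpace X] (hM : IsInvariantSubspace T M)
    (hN : IsInvariantSubspace T N) (hNc : IsClosed (N : Set X)) (hMN : IsCompl M N) :
    sigmaStar k (T.restrict hN) ⊆ sigmaStar k T := by
  have := hNc.completeSpace_coe
  intro z hz
  rw [mem_sigmaStar_iff] at hz ⊢
  exact fun h => hz (h.restrict (hM.sub_smul_id z) (hN.sub_smul_id z) hNc hMN)

theorem mem_sigmaStar_restrict [CompleteSpace X] (hN : IsInvariantSubspace T N)
    (hNc : IsClosed (N : Set X)) {z : ℂ} (hz : z ∈ sigmaStar k T)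
    (hQ : Function.Bijective (hN.sub_smul_id z).quotientMap) :
    z ∈ sigmaStar k (T.restrict hN) := by
  have := hNc.completeSpace_coe
  rw [mem_sigmaStar_iff] at hz ⊢
  exact fun h => hz (.of_restrict (hN.sub_smul_id z) hQ h)

theorem isOpen_setOf_bijective_quotientMap [CompleteSpace X] (hN : IsInvariantSubspace T N)
    (hNc : IsClosed (N : Set X)) :
    IsOpen {z : ℂ | Function.Bijective (hN.sub_smul_id z).quotientMap} := by
  have hquot (z : ℂ) : (hN.sub_smul_id z).quotientMap =
      hN.quotientMap - z • ContinuousLinearMap.id ℂ (X ⧸ N) := by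
    ext x
    obtain ⟨x, rfl⟩ := N.mkQ_surjective x
    rfl
  convert spectrum.isOpen_resolventSet (𝕜 := ℂ) hN.quotientMap
  ext z
  rw [← not_iff_not, Set.mem_ofPred_eq, hquot]
  exact mem_spectrum_iff_not_bijective.symm

theorem exists_bijective_quotientMap_ker_pow (h : IsDrazinInvertible S) :
    ∃ (n : ℕ) (hn : IsInvariantSubspace S (S ^ n).ker), Function.Bijective hn.quotientMap := by
  obtain ⟨⟨p, hp⟩, q, hq⟩ := h
  simp only [ContinuousLinearMap.toLinearMap_pow] at hp hq
  have hker : (S.toLinearMap ^ (p + q)).ker = (S.toLinearMap ^ (p + q + 1)).ker :=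
    (Module.End.ker_pow_constant hp q).symm.trans (Module.End.ker_pow_constant hp (q + 1))
  have hrange : (S.toLinearMap ^ (p + q)).range = (S.toLinearMap ^ (p + q + 1)).range := by
    rw [add_assoc, pow_add, pow_add, Module.End.mul_eq_comp, Module.End.mul_eq_comp,
      LinearMap.range_comp, LinearMap.range_comp, hq]
  have hinv (x : X) (hx : (S.toLinearMap ^ (p + q)) x = 0) :
      (S.toLinearMap ^ (p + q)) (S x) = 0 := by
    change (S.toLinearMap ^ (p + q) * S.toLinearMap) x = 0
    rw [← pow_succ, pow_succ', Module.End.mul_apply, hx, map_zero]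
  refine ⟨p + q, ?_⟩
  rw [ContinuousLinearMap.toLinearMap_pow]
  exact ⟨hinv, bijective_mapQ_ker_pow hker hrange hinv⟩

theorem IsDrazinInvertible.eventually_bijective_sub_smul_id [CompleteSpace X]
    (h : IsDrazinInvertible S) :
    ∀ᶠ z : ℂ in 𝓝[≠] 0, Function.Bijective (S - z • ContinuousLinearMap.id ℂ X) := by
  obtain ⟨n, hN, hQ⟩ := exists_bijective_quotientMap_ker_pow h
  have hNc : IsClosed ((S ^ n).ker : Set X) := (S ^ n).isClosed_ker
  have hnil : IsNilpotent (S.restrict hN) := by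
    refine ⟨n, ?_⟩
    rw [← hN.restrict_pow]
    ext x
    exact x.2
  have hQ_near : ∀ᶠ z : ℂ in 𝓝 0, Function.Bijective (hN.sub_smul_id z).quotientMap :=
    (isOpen_setOf_bijective_quotientMap hN hNc).mem_nhds (by simpa using hQ)
  filter_upwards [nhdsWithin_le_nhds hQ_near, self_mem_nhdsWithin] with z hz hz0
  refine bijective_of_restrict_of_mapQ (hN.sub_smul_id z) ?_ hz
  have := hNc.completeSpace_coe
  have hunit : IsUnit (S.restrict hN + algebraMap ℂ _ (-z)) :=
    hnil.isUnit_add_right_of_commute ((neg_ne_zero.2 hz0).isUnit.map (algebraMap ℂ _))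
      (Algebra.commute_algebraMap_right _ _)
  rw [map_neg, ← sub_eq_add_neg] at hunit
  exact ContinuousLinearMap.isUnit_iff_bijective.1 hunit

theorem derivedSet_spectrum_subset_sigmaStar [CompleteSpace X] :
    derivedSet (spectrum ℂ T) ⊆ sigmaStar k T := by
  intro z hz
  rw [mem_sigmaStar_iff]
  intro hreg
  have hnear := hreg.isDrazinInvertible.eventually_bijective_sub_smul_id
  have hmap : Tendsto (fun w : ℂ => w - z) (𝓝[≠] z) (𝓝[≠] 0) := by
    rw [tendsto_nhdsWithin_iff]
    refine ⟨((continuous_sub_right z).tendsto' z 0 (sub_self z)).mono_left nhdsWithin_le_nhds, ?_⟩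
    filter_upwards [self_mem_nhdsWithin] with w hw using sub_ne_zero.2 hw
  rw [mem_derivedSet, accPt_iff_frequently_nhdsNE] at hz
  refine hz ((hmap.eventually hnear).mono fun w hw hwT => ?_)
  rw [sub_sub, ← add_smul, add_sub_cancel] at hw
  exact mem_spectrum_iff_not_bijective.1 hwT hw

end SigmaStar

section RieszProjection

open Metric Real Complex

section CircleIntegral

variable {E F A : Type*} [NormedAddCommGroup E] [NormedSpace ℂ E] [CompleteSpace E]
  [NormedAddCommGroup F] [NormedSpace ℂ F] [CompleteSpace F]
  [NormedRing A] [NormedAlgebra ℂ A] [CompleteSpace A] {c w : ℂ} {r : ℝ}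

theorem circleIntegral_clm_comp_comm (L : E →L[ℂ] F) {f : ℂ → E} (hf : CircleIntegrable f c r) :
    (∮ z in C(c, r), L (f z)) = L (∮ z in C(c, r), f z) := by
  simp only [circleIntegral, ← map_smul]
  exact L.intervalIntegral_comp_comm hf.out

theorem circleIntegral_const_mul_of_circleIntegrable {f : ℂ → A} (hf : CircleIntegrable f c r)
    (b : A) : (∮ z in C(c, r), b * f z) = b * ∮ z in C(c, r), f z :=
  circleIntegral_clm_comp_comm (ContinuousLinearMap.mul ℂ A b) hf

theorem circleIntegral_mul_const_of_circleIntegrable {f : ℂ → A} (hf : CircleIntegrable f c r)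
    (b : A) : (∮ z in C(c, r), f z * b) = (∮ z in C(c, r), f z) * b :=
  circleIntegral_clm_comp_comm ((ContinuousLinearMap.mul ℂ A).flip b) hf

theorem commute_circleIntegral (hr : 0 ≤ r) {f : ℂ → A} (hf : CircleIntegrable f c r) {b : A}
    (h : ∀ z ∈ sphere c r, Commute b (f z)) : Commute b (∮ z in C(c, r), f z) := by
  rw [commute_iff_eq, ← circleIntegral_const_mul_of_circleIntegrable hf,
    ← circleIntegral_mul_const_of_circleIntegrable hf]
  exact circleIntegral.integral_congr hr fun z hz => (h z hz).eq

theorem circleIntegral_sub_inv_of_notMem_closedBall (hr : 0 ≤ r) (hw : w ∉ closedBall c r) :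
    (∮ z in C(c, r), (z - w)⁻¹) = 0 :=
  DiffContOnCl.circleIntegral_eq_zero hr <| DifferentiableOn.diffContOnCl_ball
    (fun _ hz => ((differentiableAt_id.sub_const w).inv
      (sub_ne_zero.2 fun hzw => hw (hzw ▸ hz))).differentiableWithinAt) subset_rfl

theorem continuousOn_sub_inv_sphere (hw : w ∉ sphere c r) :
    ContinuousOn (fun z => (z - w)⁻¹) (sphere c r) :=
  (continuousOn_id.sub continuousOn_const).inv₀ fun z hz =>
    sub_ne_zero.2 fun hzw : z = w => hw (hzw ▸ hz)

end CircleIntegral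

section Resolvent

variable {A : Type*} [NormedRing A] [NormedAlgebra ℂ A] {a b : A} {z : ℂ}

theorem commute_resolvent (h : Commute b a) (z : ℂ) : Commute b (resolvent a z) := by
  have hcomm : Commute b (algebraMap ℂ A z - a) :=
    (Algebra.commute_algebraMap_right z b).sub_right h
  by_cases hz : IsUnit (algebraMap ℂ A z - a)
  · obtain ⟨u, hu⟩ := hz
    rw [← hu] at hcomm
    rw [resolvent, ← hu, Ring.inverse_unit]
    exact hcomm.units_inv_right
  · rw [resolvent, Ring.inverse_non_unit _ hz]
    exact Commute.zero_right b

theorem sub_algebraMap_mul_resolvent (hz : z ∈ resolventSet ℂ a) (w : ℂ) :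
    (a - algebraMap ℂ A w) * resolvent a z = (z - w) • resolvent a z - 1 := by
  have hinv : (algebraMap ℂ A z - a) * resolvent a z = 1 := Ring.mul_inverse_cancel _ hz
  have hsplit : a - algebraMap ℂ A w = algebraMap ℂ A (z - w) - (algebraMap ℂ A z - a) := by
    rw [map_sub]
    abel
  rw [hsplit, sub_mul, hinv, Algebra.smul_def]

theorem differentiableOn_resolvent [CompleteSpace A] (a : A) :
    DifferentiableOn ℂ (resolvent a) (resolventSet ℂ a) :=
  fun _ hz => (spectrum.hasDerivAt_resolvent_const_left hz).differentiableAt.differentiableWithinAt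

end Resolvent

variable {A : Type*} [NormedRing A] [NormedAlgebra ℂ A] {a b : A} {c w : ℂ} {r s : ℝ}

/-- The Cauchy integral of the resolvent of `a` over the circle with centre `c` and radius `r`. Up
to sign it is inverse to `a - w` on one of the two parts into which the circle splits the spectrum
of `a`: the outer part if `w` lies inside the circle and the inner part if `w` lies outside. -/
noncomputable def resolventCauchyIntegral (a : A) (c : ℂ) (r : ℝ) (w : ℂ) : A :=
  (2 * π * I : ℂ)⁻¹ • ∮ z in C(c, r), (z - w)⁻¹ • resolvent a z

/-- The Riesz projection of `a` belonging to the part of its spectrum inside the circle with centre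
`c` and radius `r`. -/
noncomputable def rieszProjection (a : A) (c : ℂ) (r : ℝ) : A :=
  (2 * π * I : ℂ)⁻¹ • ∮ z in C(c, r), resolvent a z

variable [CompleteSpace A]

theorem circleIntegrable_resolvent (hr : 0 ≤ r) (h : sphere c r ⊆ resolventSet ℂ a) :
    CircleIntegrable (resolvent a) c r :=
  ((differentiableOn_resolvent a).continuousOn.mono h).circleIntegrable hr

theorem circleIntegrable_sub_inv_smul_resolvent (hr : 0 ≤ r) (h : sphere c r ⊆ resolventSet ℂ a)
    (hw : w ∉ sphere c r) : CircleIntegrable (fun z => (z - w)⁻¹ • resolvent a z) c r :=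
  ((continuousOn_sub_inv_sphere hw).smul
    ((differentiableOn_resolvent a).continuousOn.mono h)).circleIntegrable hr

theorem commute_rieszProjection (hr : 0 ≤ r) (h : sphere c r ⊆ resolventSet ℂ a)
    (hb : Commute b a) : Commute b (rieszProjection a c r) :=
  (commute_circleIntegral hr (circleIntegrable_resolvent hr h)
    fun z _ => commute_resolvent hb z).smul_right _

theorem commute_resolventCauchyIntegral (hr : 0 ≤ r) (h : sphere c r ⊆ resolventSet ℂ a)
    (hw : w ∉ sphere c r) (hb : Commute b a) : Commute b (resolventCauchyIntegral a c r w) :=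
  (commute_circleIntegral hr (circleIntegrable_sub_inv_smul_resolvent hr h hw)
    fun z _ => (commute_resolvent hb z).smul_right _).smul_right _

theorem sub_mul_resolventCauchyIntegral (hr : 0 ≤ r) (h : sphere c r ⊆ resolventSet ℂ a)
    (hw : w ∉ sphere c r) :
    (a - algebraMap ℂ A w) * resolventCauchyIntegral a c r w =
      rieszProjection a c r - ((2 * π * I : ℂ)⁻¹ * ∮ z in C(c, r), (z - w)⁻¹) • 1 := by
  have hint : CircleIntegrable (fun z => (z - w)⁻¹ • (1 : A)) c r :=
    ((continuousOn_sub_inv_sphere hw).smul continuousOn_const).circleIntegrable hr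
  rw [resolventCauchyIntegral, mul_smul_comm, ← circleIntegral_const_mul_of_circleIntegrable
      (circleIntegrable_sub_inv_smul_resolvent hr h hw),
    rieszProjection, mul_smul, ← circleIntegral.integral_smul_const, ← smul_sub,
    ← circleIntegral.integral_sub (circleIntegrable_resolvent hr h) hint]
  congr 1
  refine circleIntegral.integral_congr hr fun z hz => ?_
  have hzw : z - w ≠ 0 := sub_ne_zero.2 fun hzw => hw (hzw ▸ hz)
  rw [mul_smul_comm, sub_algebraMap_mul_resolvent (h hz), smul_sub, inv_smul_smul₀ hzw]

theorem sub_mul_resolventCauchyIntegral_of_mem_ball (h : sphere c r ⊆ resolventSet ℂ a)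
    (hw : w ∈ ball c r) :
    (a - algebraMap ℂ A w) * resolventCauchyIntegral a c r w = rieszProjection a c r - 1 := by
  rw [sub_mul_resolventCauchyIntegral (pos_of_mem_ball hw).le h
      (Set.disjoint_left.1 (sphere_disjoint_ball.symm) hw),
    circleIntegral.integral_sub_inv_of_mem_ball hw, inv_mul_cancel₀ two_pi_I_ne_zero, one_smul]

theorem sub_mul_resolventCauchyIntegral_of_notMem_closedBall (hr : 0 ≤ r)
    (h : sphere c r ⊆ resolventSet ℂ a) (hw : w ∉ closedBall c r) :
    (a - algebraMap ℂ A w) * resolventCauchyIntegral a c r w = rieszProjection a c r := by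
  rw [sub_mul_resolventCauchyIntegral hr h (mt (@sphere_subset_closedBall _ _ c r w) hw),
    circleIntegral_sub_inv_of_notMem_closedBall hr hw, mul_zero, zero_smul, sub_zero]

theorem differentiableOn_resolventCauchyIntegral (h : sphere c r ⊆ resolventSet ℂ a) :
    DifferentiableOn ℂ (resolventCauchyIntegral a c r) (ball c r) := by
  rcases le_or_gt r 0 with hr | hr
  · rw [ball_eq_empty.2 hr]
    exact differentiableOn_empty
  lift r to NNReal using hr.le
  have := (hasFPowerSeriesOn_cauchy_integral (circleIntegrable_resolvent hr.le h) hr)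
    |>.differentiableOn
  rwa [Metric.eball_coe] at this

theorem circleIntegral_resolventCauchyIntegral (hs : 0 ≤ s) (hsr : s < r)
    (h : sphere c r ⊆ resolventSet ℂ a) :
    (∮ w in C(c, s), resolventCauchyIntegral a c r w) = 0 :=
  ((differentiableOn_resolventCauchyIntegral h).diffContOnCl_ball
    (closedBall_subset_ball hsr)).circleIntegral_eq_zero hs

theorem rieszProjection_eq_of_annulus_subset (hs : 0 < s) (hsr : s ≤ r)
    (h : closedBall c r \ ball c s ⊆ resolventSet ℂ a) :
    rieszProjection a c r = rieszProjection a c s := by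
  have hdiff (z : ℂ) (hz : z ∈ resolventSet ℂ a) : DifferentiableAt ℂ (resolvent a) z :=
    (differentiableOn_resolvent a).differentiableAt
      ((spectrum.isOpen_resolventSet a).mem_nhds hz)
  rw [rieszProjection, rieszProjection,
    circleIntegral_eq_of_differentiable_on_annulus_off_countable hs hsr Set.countable_empty
      ((differentiableOn_resolvent a).continuousOn.mono h) fun z hz =>
        hdiff z (h (Set.sdiff_subset_sdiff ball_subset_closedBall ball_subset_closedBall hz.1))]

theorem exists_annulus_subset_resolventSet (hr : 0 < r) (h : sphere c r ⊆ resolventSet ℂ a) :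
    ∃ s ∈ Set.Ioo 0 r, closedBall c r \ ball c s ⊆ resolventSet ℂ a := by
  have hball : spectrum ℂ a ∩ closedBall c r ⊆ ball c r := fun z hz =>
    hz.2.lt_of_ne fun hzr => hz.1 (h hzr)
  obtain ⟨s, hs, hsub⟩ :=
    exists_pos_lt_subset_ball hr ((spectrum.isClosed a).inter isClosed_closedBall) hball
  exact ⟨s, hs, fun z hz => of_not_not fun hza => hz.2 (hsub ⟨hza, hz.1⟩)⟩

theorem resolvent_mul_rieszProjection (h : sphere c r ⊆ resolventSet ℂ a) (hw : w ∈ ball c r)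
    (hwa : w ∈ resolventSet ℂ a) :
    resolvent a w * rieszProjection a c r =
      resolvent a w - resolventCauchyIntegral a c r w := by
  have hinv : resolvent a w * (algebraMap ℂ A w - a) = 1 := Ring.inverse_mul_cancel _ hwa
  calc resolvent a w * rieszProjection a c r
      = resolvent a w * (1 - (algebraMap ℂ A w - a) * resolventCauchyIntegral a c r w) := by
        rw [← neg_sub a, neg_mul, sub_mul_resolventCauchyIntegral_of_mem_ball h hw]
        abel_nf
    _ = resolvent a w - resolventCauchyIntegral a c r w := by
        rw [mul_sub, mul_one, ← mul_assoc, hinv, one_mul]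

theorem isIdempotentElem_rieszProjection (hr : 0 < r) (h : sphere c r ⊆ resolventSet ℂ a) :
    IsIdempotentElem (rieszProjection a c r) := by
  obtain ⟨s, ⟨hs, hsr⟩, hann⟩ := exists_annulus_subset_resolventSet hr h
  have hsphere : sphere c s ⊆ resolventSet ℂ a := fun z hz =>
    hann ⟨sphere_subset_closedBall.trans (closedBall_subset_closedBall hsr.le) hz,
      Set.disjoint_left.1 sphere_disjoint_ball hz⟩
  have hsub : sphere c s ⊆ ball c r := sphere_subset_closedBall.trans (closedBall_subset_ball hsr)
  have hres := circleIntegrable_resolvent hs.le hsphere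
  have hcauchy : CircleIntegrable (resolventCauchyIntegral a c r) c s :=
    ((differentiableOn_resolventCauchyIntegral h).continuousOn.mono hsub).circleIntegrable hs.le
  have hmul : (∮ w in C(c, s), resolvent a w) * rieszProjection a c r =
      ∮ w in C(c, s), resolvent a w := by
    calc (∮ w in C(c, s), resolvent a w) * rieszProjection a c r
        = ∮ w in C(c, s), (resolvent a w - resolventCauchyIntegral a c r w) := by
          rw [← circleIntegral_mul_const_of_circleIntegrable hres]
          exact circleIntegral.integral_congr hs.le fun w hw =>
            resolvent_mul_rieszProjection h (hsub hw) (hsphere hw)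
      _ = ∮ w in C(c, s), resolvent a w := by
          rw [circleIntegral.integral_sub hres hcauchy,
            circleIntegral_resolventCauchyIntegral hs.le hsr h, sub_zero]
  have heq := rieszProjection_eq_of_annulus_subset hs hsr.le hann
  suffices rieszProjection a c s * rieszProjection a c r = rieszProjection a c s by
    rwa [← heq] at this
  rw [rieszProjection, smul_mul_assoc, hmul]

end RieszProjection

section SpectralDecomposition

open Metric

variable {X : Type u} [NormedAddCommGroup X] [NormedSpace ℂ X] {S R T : X →L[ℂ] X}
  {N : Submodule ℂ X}

theorem isInvariantSubspace_ker_of_commute (h : Commute S T) : IsInvariantSubspace S T.ker :=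
  fun x (hx : T x = 0) =>
    (DFunLike.congr_fun h.eq.symm x).trans ((congrArg S hx).trans (map_zero S))

theorem isInvariantSubspace_range_of_commute (h : Commute S T) :
    IsInvariantSubspace S T.range := by
  rintro _ ⟨x, rfl⟩
  exact ⟨S x, (DFunLike.congr_fun h.eq x).symm⟩

theorem bijective_restrict_of_commute (hS : IsInvariantSubspace S N)
    (hR : IsInvariantSubspace R N) (h : Commute S R) (hSR : ∀ x ∈ N, S (R x) = x) :
    Function.Bijective (S.restrict hS) := by
  refine Function.bijective_iff_has_inverse.2 ⟨R.restrict hR, fun x => ?_, fun x => ?_⟩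
  · exact Subtype.ext ((DFunLike.congr_fun h.eq x.1).symm.trans (hSR x x.2))
  · exact Subtype.ext (hSR x x.2)

theorem notMem_spectrum_restrict_of_commute [CompleteSpace X] (hN : IsInvariantSubspace T N)
    (hNc : IsClosed (N : Set X)) (hR : IsInvariantSubspace R N) (h : Commute T R) {z : ℂ}
    (hTR : ∀ x ∈ N, (T - algebraMap ℂ (X →L[ℂ] X) z) (R x) = x) :
    z ∉ spectrum ℂ (T.restrict hN) := by
  have := hNc.completeSpace_coe
  rw [mem_spectrum_iff_not_bijective, not_not]
  exact bijective_restrict_of_commute (hN.sub_smul_id z) hR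
    (h.sub_left (Algebra.commute_algebraMap_left z R)) hTR

theorem exists_isCompl_spectrum_restrict [CompleteSpace X] {c : ℂ} {r : ℝ} (hr : 0 < r)
    (h : sphere c r ⊆ resolventSet ℂ T) :
    ∃ (M N : Submodule ℂ X) (hM : IsInvariantSubspace T M) (hN : IsInvariantSubspace T N),
      IsClosed (M : Set X) ∧ IsClosed (N : Set X) ∧ IsCompl M N ∧
        Disjoint (spectrum ℂ (T.restrict hM)) (ball c r) ∧
          spectrum ℂ (T.restrict hN) ⊆ closedBall c r := by
  set P : X →L[ℂ] X := rieszProjection T c r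
  have hP : IsIdempotentElem P := isIdempotentElem_rieszProjection hr h
  have hcomm {S : X →L[ℂ] X} (hS : Commute S T) : Commute S P := commute_rieszProjection hr.le h hS
  have hcauchy {w : ℂ} (hw : w ∉ sphere c r) : Commute T (resolventCauchyIntegral T c r w) :=
    commute_resolventCauchyIntegral hr.le h hw (.refl T)
  refine ⟨P.ker, P.range, isInvariantSubspace_ker_of_commute (hcomm (.refl T)),
    isInvariantSubspace_range_of_commute (hcomm (.refl T)), P.isClosed_ker,
    ContinuousLinearMap.IsIdempotentElem.isClosed_range hP,
    (ContinuousLinearMap.IsIdempotentElem.isTopCompl hP).isCompl.symm, ?_, ?_⟩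
  · refine Set.disjoint_right.2 fun w hw => ?_
    have hR := hcauchy (Set.disjoint_left.1 sphere_disjoint_ball.symm hw)
    refine notMem_spectrum_restrict_of_commute _ P.isClosed_ker
      (isInvariantSubspace_ker_of_commute (hcomm hR.symm.neg_left)) hR.neg_right fun x hx => ?_
    have hPx : P x = 0 := hx
    calc (T - algebraMap ℂ (X →L[ℂ] X) w) (-resolventCauchyIntegral T c r w x)
        = -(P x - x) := by
          rw [map_neg]
          exact congrArg Neg.neg
            (DFunLike.congr_fun (sub_mul_resolventCauchyIntegral_of_mem_ball h hw) x)
      _ = x := by rw [hPx, zero_sub, neg_neg]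
  · refine fun w hw => by_contra fun hwr => ?_
    have hR := hcauchy (mt (@sphere_subset_closedBall _ _ c r w) hwr)
    refine notMem_spectrum_restrict_of_commute _
      (ContinuousLinearMap.IsIdempotentElem.isClosed_range hP)
      (isInvariantSubspace_range_of_commute (hcomm hR.symm)) hR ?_ hw
    rintro _ ⟨x, rfl⟩
    calc (T - algebraMap ℂ (X →L[ℂ] X) w) (resolventCauchyIntegral T c r w (P x))
        = P (P x) := DFunLike.congr_fun
          (sub_mul_resolventCauchyIntegral_of_notMem_closedBall hr.le h hwr) (P x)
      _ = P x := DFunLike.congr_fun hP.eq x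

end SpectralDecomposition

section GInvertible

open Metric

variable {X : Type u} [NormedAddCommGroup X] [NormedSpace ℂ X] {k : SpectrumKind} {T : X →L[ℂ] X}
  {N : Submodule ℂ X}

theorem isGInvertible_add_one_iff {γ : Ordinal.{v}} :
    IsGInvertible k T (γ + 1) ↔ HasGDecomposition k T γ := by
  refine ⟨?_, fun h => .inr (.inl ⟨γ, rfl, h⟩)⟩
  rintro (⟨h, -⟩ | ⟨δ, hδ, h⟩ | ⟨h, -⟩)
  · exact absurd h (Order.bot_lt_succ γ).ne'
  · rwa [Order.succ_injective hδ]
  · exact absurd h (Order.not_isSuccLimit_succ γ)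

variable [CompleteSpace X]

theorem exists_ball_inter_sigmaStar_subset (hN : IsInvariantSubspace T N)
    (hNc : IsClosed (N : Set X)) (hQ : Function.Bijective hN.quotientMap) :
    ∃ ε > 0, sigmaStar k T ∩ closedBall 0 ε ⊆ sigmaStar k (T.restrict hN) := by
  have hnhds : {z : ℂ | Function.Bijective (hN.sub_smul_id z).quotientMap} ∈ 𝓝 0 :=
    (isOpen_setOf_bijective_quotientMap hN hNc).mem_nhds (by simpa using hQ)
  obtain ⟨ε, hε, hball⟩ := nhds_basis_closedBall.mem_iff.1 hnhds
  exact ⟨ε, hε, fun z hz => mem_sigmaStar_restrict hN hNc hz.1 (hball hz.2)⟩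

theorem countable_spectrum_inter {C : Set ℂ} (hC : IsClosed C) {γ : Ordinal.{v}}
    (h : (accIter (sigmaStar k T ∩ C) γ).Subsingleton) : (spectrum ℂ T ∩ C).Countable := by
  have hsub : derivedSet (spectrum ℂ T ∩ C) ⊆ sigmaStar k T ∩ C := Set.subset_inter
    ((derivedSet_mono _ _ Set.inter_subset_left).trans derivedSet_spectrum_subset_sigmaStar)
    ((derivedSet_mono _ _ Set.inter_subset_right).trans ((isClosed_iff_derivedSet_subset C).1 hC))
  exact countable_of_subsingleton_accIter_derivedSet ((spectrum.isClosed T).inter hC)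
    (h.anti (accIter_mono hsub γ))

theorem hasGDecomposition_of_bijective_quotientMap {γ : Ordinal.{v}}
    (hN : IsInvariantSubspace T N) (hNc : IsClosed (N : Set X))
    (hQ : Function.Bijective hN.quotientMap)
    (hacc : accIter (sigmaStar k (T.restrict hN)) γ ⊆ {0}) : HasGDecomposition k T γ := by
  obtain ⟨ε, hε, hsub⟩ := exists_ball_inter_sigmaStar_subset (k := k) hN hNc hQ
  have hacc' : accIter (sigmaStar k T ∩ closedBall 0 ε) γ ⊆ {0} := (accIter_mono hsub γ).trans hacc
  obtain ⟨r, ⟨hr, hrε⟩, hsphere⟩ := exists_sphere_subset_compl_of_countable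
    (countable_spectrum_inter isClosed_closedBall (Set.subsingleton_singleton.anti hacc')) 0 hε
  have hball : closedBall (0 : ℂ) r ⊆ closedBall 0 ε := closedBall_subset_closedBall hrε.le
  have hres : sphere 0 r ⊆ resolventSet ℂ T := fun z hz => of_not_not fun hzT =>
    hsphere hz ⟨hzT, hball (sphere_subset_closedBall hz)⟩
  obtain ⟨M', N', hM', hN', hMc', hNc', hcompl, hdisj, hσ⟩ :=
    exists_isCompl_spectrum_restrict hr hres
  have hunit : IsUnit (T.restrict hM') :=
    (spectrum.zero_notMem_iff ℂ).1 (Set.disjoint_right.1 hdisj (mem_ball_self hr))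
  have := hNc'.completeSpace_coe
  have hσ' : sigmaStar k (T.restrict hN') ⊆ sigmaStar k T ∩ closedBall 0 ε :=
    Set.subset_inter (sigmaStar_restrict_subset hM' hN' hNc' hcompl)
      ((sigmaStar_subset_spectrum.trans hσ).trans hball)
  exact ⟨M', N', hM', hN', hMc', hNc', hcompl, hunit, (accIter_mono hσ' γ).trans hacc'⟩

end GInvertible

theorem mainTheorem5_general {X : Type u} [NormedAddCommGroup X] [NormedSpace ℂ X]
    [CompleteSpace X] (k : SpectrumKind) (T : X →L[ℂ] X) (γ : Ordinal.{v}) :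
    List.TFAE [
      IsGInvertible k T (γ + 1),
      ∃ (M N : Submodule ℂ X) (hM : IsInvariantSubspace T M) (hN : IsInvariantSubspace T N),
        IsClosed (N : Set X) ∧ IsCompl M N ∧ Function.Bijective (T.restrict hM) ∧
          accIter (sigmaStar k (T.restrict hN)) γ ⊆ {0},
      ∃ (N : Submodule ℂ X) (hN : IsInvariantSubspace T N),
        IsClosed (N : Set X) ∧ Function.Bijective hN.quotientMap ∧
          accIter (sigmaStar k (T.restrict hN)) γ ⊆ {0}] := by
  rw [isGInvertible_add_one_iff]
  tfae_have 1 → 2 := by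
    rintro ⟨M, N, hM, hN, hMc, hNc, hMN, hunit, hacc⟩
    have := hMc.completeSpace_coe
    exact ⟨M, N, hM, hN, hNc, hMN, ContinuousLinearMap.isUnit_iff_bijective.1 hunit, hacc⟩
  tfae_have 2 → 3 := by
    rintro ⟨M, N, hM, hN, hNc, hMN, hbij, hacc⟩
    exact ⟨N, hN, hNc, bijective_mapQ_of_isCompl hM hN hMN hbij, hacc⟩
  tfae_have 3 → 1 := by
    rintro ⟨N, hN, hNc, hQ, hacc⟩
    exact hasGDecomposition_of_bijective_quotientMap hN hNc hQ hacc
  tfae_finish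

theorem mainTheorem5 {X : Type u} [NormedAddCommGroup X] [NormedSpace ℂ X] [CompleteSpace X]
    (k : SpectrumKind) (T : X →L[ℂ] X) (α γ : Ordinal.{v}) (hα : α = γ + 1) :
    IsGInvertible k T α ↔
      ∃ (M N : Submodule ℂ X) (hM : IsInvariantSubspace T M) (hN : IsInvariantSubspace T N),
        IsClosed (N : Set X) ∧ IsCompl M N ∧ Function.Bijective (T.restrict hM) ∧
          accIter (sigmaStar k (T.restrict hN)) γ ⊆ {0} := by
  subst hα
  exact (mainTheorem5_general k T γ).out 0 1
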